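/- Let $\mathbb F$ be a field and let $R$ be a polynomial ring over $\mathbb F$ in finitely many variables, graded so that every variable has degree $2$; thus $R_2$ is the space of linear forms. Let $n\ge 2$ and let $\underline x=(x_1,\dots,x_n)$ be a sequence of linearly independent (over $\mathbb F$) elements of $R_2$. The string module is the $R$-submodule $$\mathrm{St}_R(\underline x)=\{(f_1,\dots,f_{n-1})\in R^{\oplus n-1} : f_1\equiv 0 \ (\mathrm{mod}\ x_1),\ f_{n-1}\equiv 0\ (\mathrm{mod}\ x_n),\ f_i\equiv f_{i-1}\ (\mathrm{mod}\ x_i)\text{ for } 2\le i\le n-1\},$$ graded as a submodule of $R^{\oplus n-1}$, whose standard generators have degree $0$. For a graded $R$-module $M$ let $M(k)$ denote the shifted module $M(k)_i=M_{k+i}$, and let $M^\vee=\bigoplus_{k\in\mathbb Z}\mathrm{Hom}_R^k(M,R)$ be its graded dual, where $\mathrm{Hom}^k_R(M,R)$ consists of the $R$-linear maps $\phi:M\to R$ with $\phi(M_i)\subseteq R_{k+i}$ for all $i$. Then: 1. The projective dimension of $\mathrm{St}_R(\underline x)$ over $R$ equals $n-2$. 2. If $n\ge 3$, there is an exact sequence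 of graded $R$-modules and homomorphisms of degree $0$ $$0\to R\to R(2)^{\oplus n}\to \mathrm{St}_R(\underline x)^\vee\to 0;$$ in particular, the projective dimension of $\mathrm{St}_R(\underline x)^\vee$ over $R$ is at most $1$. -/

import Mathlib

open CategoryTheory

namespace StringModule

/-- The degree `d` part `R_d` (with `d ∈ ℤ`) of the polynomial ring `R = F[σ]`, graded so that
every variable has degree `2`. -/
noncomputable def polyGrading (F σ : Type*) [Field F] (d : ℤ) :
    AddSubgroup (MvPolynomial σ F) :=
  (MvPolynomial.weightedHomogeneousSubmodule F (fun _ : σ => (2 : ℤ)) d).toAddSubgroup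

/-- The grading of the shifted module `M(k)`: it is `M` with `M(k)_i = M_{k+i}`. -/
def shift {M : Type*} [AddCommGroup M] (ℳ : ℤ → AddSubgroup M) (k : ℤ) : ℤ → AddSubgroup M :=
  fun i => ℳ (k + i)

/-- The grading of the direct sum `M^{⊕ ι}` of copies of a graded module `M`. -/
def powGrading (ι : Type*) {M : Type*} [AddCommGroup M] (ℳ : ℤ → AddSubgroup M) :
    ℤ → AddSubgroup (ι → M) :=
  fun d => AddSubgroup.pi Set.univ fun _ => ℳ d

/-- The group `Hom_R^k(M, N)` of `R`-linear maps of degree `k`: those `φ` with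
`φ(M_i) ⊆ N_{k+i}` for all `i ∈ ℤ`. -/
def homDegree {R M N : Type*} [CommRing R] [AddCommGroup M] [Module R M]
    [AddCommGroup N] [Module R N] (ℳ : ℤ → AddSubgroup M) (𝒩 : ℤ → AddSubgroup N) (k : ℤ) :
    AddSubgroup (M →ₗ[R] N) where
  carrier := {φ | ∀ i : ℤ, ∀ m ∈ ℳ i, φ m ∈ 𝒩 (k + i)}
  zero_mem' := fun i _ _ => (𝒩 (k + i)).zero_mem
  add_mem' := fun ha hb i m hm => (𝒩 (k + i)).add_mem (ha i m hm) (hb i m hm)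
  neg_mem' := fun ha i m hm => (𝒩 (k + i)).neg_mem (ha i m hm)

theorem smul_mem_homDegree {F σ M : Type*} [Field F] [AddCommGroup M]
    [Module (MvPolynomial σ F) M] (ℳ : ℤ → AddSubgroup M) {j k : ℤ} {r : MvPolynomial σ F}
    (hr : r ∈ polyGrading F σ j) {φ : M →ₗ[MvPolynomial σ F] MvPolynomial σ F}
    (hφ : φ ∈ homDegree ℳ (polyGrading F σ) k) :
    r • φ ∈ homDegree ℳ (polyGrading F σ) (j + k) := by
  intro i m hm
  have h := MvPolynomial.IsWeightedHomogeneous.mul (w := fun _ : σ => (2 : ℤ)) hr (hφ i m hm)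
  rw [← add_assoc] at h
  exact h

/-- The graded dual `M^∨ = Hom_R^•(M, R) = ⨁_k Hom_R^k(M, R)` of a graded module `M` over the
graded polynomial ring `R = F[σ]`, as an `R`-submodule of `Hom_R(M, R)`. -/
noncomputable def gradedDual {F σ M : Type*} [Field F] [AddCommGroup M]
    [Module (MvPolynomial σ F) M] (ℳ : ℤ → AddSubgroup M) :
    Submodule (MvPolynomial σ F) (M →ₗ[MvPolynomial σ F] MvPolynomial σ F) where
  carrier := {φ | φ ∈ ⨆ k : ℤ, homDegree ℳ (polyGrading F σ) k}
  zero_mem' := (⨆ k : ℤ, homDegree ℳ (polyGrading F σ) k).zero_mem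
  add_mem' := fun ha hb => (⨆ k : ℤ, homDegree ℳ (polyGrading F σ) k).add_mem ha hb
  smul_mem' := by
    intro r φ hφ
    refine AddSubgroup.iSup_induction (homDegree ℳ (polyGrading F σ))
      (C := fun φ => r • φ ∈ ⨆ k : ℤ, homDegree ℳ (polyGrading F σ) k) hφ ?_ ?_ ?_
    · intro k φ hk
      induction r using MvPolynomial.induction_on' with
      | monomial u a =>
        exact AddSubgroup.mem_iSup_of_mem _ (smul_mem_homDegree ℳ
          (MvPolynomial.isWeightedHomogeneous_monomial (fun _ : σ => (2 : ℤ)) u a rfl) hk)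
      | add p q hp hq =>
        rw [add_smul]
        exact AddSubgroup.add_mem _ hp hq
    · rw [smul_zero]
      exact AddSubgroup.zero_mem _
    · intro φ ψ h1 h2
      rw [smul_add]
      exact AddSubgroup.add_mem _ h1 h2

/-- The grading of the graded dual: its degree `k` part is `Hom_R^k(M, R)`. -/
noncomputable def gradedDualGrading {F σ M : Type*} [Field F] [AddCommGroup M]
    [Module (MvPolynomial σ F) M] (ℳ : ℤ → AddSubgroup M) :
    ℤ → AddSubgroup (gradedDual (F := F) (σ := σ) ℳ) :=
  fun k => (homDegree ℳ (polyGrading F σ) k).comap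
    (gradedDual (F := F) (σ := σ) ℳ).subtype.toAddMonoidHom

/-- The string module `St_R(x_1, …, x_n)` of a sequence of length `n = m + 2`: all
`(f_1, …, f_{n-1})` with `f_1 ≡ 0 mod x_1`, `f_{n-1} ≡ 0 mod x_n` and
`f_i ≡ f_{i-1} mod x_i` for `2 ≤ i ≤ n - 1`. Indices are shifted to start from `0`. -/
def stringModule {R : Type*} [CommRing R] {m : ℕ} (x : Fin (m + 2) → R) :
    Submodule R (Fin (m + 1) → R) where
  carrier := {f | x 0 ∣ f 0 ∧ x (Fin.last (m + 1)) ∣ f (Fin.last m) ∧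
    ∀ i : Fin m, x i.succ.castSucc ∣ f i.succ - f i.castSucc}
  zero_mem' := by simp
  add_mem' := by
    rintro f g ⟨f1, f2, f3⟩ ⟨g1, g2, g3⟩
    refine ⟨dvd_add f1 g1, dvd_add f2 g2, fun i => ?_⟩
    have h := dvd_add (f3 i) (g3 i)
    simpa only [Pi.add_apply, add_sub_add_comm] using h
  smul_mem' := by
    rintro r f ⟨f1, f2, f3⟩
    refine ⟨Dvd.dvd.mul_left f1 r, Dvd.dvd.mul_left f2 r, fun i => ?_⟩
    have h := Dvd.dvd.mul_left (f3 i) r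
    simpa only [Pi.smul_apply, smul_eq_mul, mul_sub] using h

/-- The grading of the string module induced from `R^{⊕ n-1}`, whose standard generators have
degree `0`. -/
noncomputable def stringGrading {F σ : Type*} [Field F] {m : ℕ}
    (x : Fin (m + 2) → MvPolynomial σ F) : ℤ → AddSubgroup (stringModule x) :=
  fun d => (powGrading (Fin (m + 1)) (polyGrading F σ) d).comap
    (stringModule x).subtype.toAddMonoidHom

end StringModule

/-! Put `x_j h_j = f_j - f_{j-1}`, with `f` padded by `0` at both ends. The differences sum to zero
and determine `f`, so `f ↦ h` identifies the string module with the first syzygies of `x`, the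
kernel of `R^n → I = (x_1, …, x_n)`.

A linear change of coordinates turns the `x_j` into variables, so they form a regular sequence in
any order. Hence `R/I` has projective dimension exactly `n`, and the sequences `0 → St → R^n → I →
0` and `0 → I → R → R/I → 0` give `n - 2` for `St`.

For the dual, restrict functionals from `R^n` to the syzygies. Those vanishing on the Koszul
syzygies are the multiples of `x`. When `n ≥ 3`, every functional on the syzygies extends to `R^n`:
this is `exists_forall_syzygy_eq`, and a third form is what makes it work. Since `f ↦ h` lowers
degree by `2`, the free module appears as `R(2)^n`. -/

namespace StringModule

/-! ### Independent linear forms as a regular sequence. -/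

section LinearForms

variable {F σ : Type*} [Field F]

theorem weight_two_eq (d : σ →₀ ℕ) :
    Finsupp.weight (fun _ : σ => (2 : ℤ)) d = 2 * (d.degree : ℤ) := by
  rw [Finsupp.weight_apply, Finsupp.sum, Finsupp.degree_apply]
  push_cast
  rw [Finset.mul_sum]
  exact Finset.sum_congr rfl fun i _ => by rw [nsmul_eq_mul, mul_comm]

theorem exists_linearCombination_X {p : MvPolynomial σ F} (hp : p ∈ polyGrading F σ 2) :
    ∃ v : σ →₀ F,
      Finsupp.linearCombination F (MvPolynomial.X : σ → MvPolynomial σ F) v = p := by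
  have h1 : p ∈ MvPolynomial.homogeneousSubmodule σ F 1 := by
    intro d hd
    have h : Finsupp.weight (fun _ : σ => (2 : ℤ)) d = 2 := hp hd
    rw [weight_two_eq] at h
    have h' : d.degree = 1 := by lia
    rw [← h']
    exact (DFunLike.congr_fun (Finsupp.degree_eq_weight_one (R := ℕ)) d).symm
  rw [MvPolynomial.homogeneousSubmodule_one_eq_span_X] at h1
  exact (Finsupp.mem_span_range_iff_exists_finsupp).1 h1

theorem constantCoeff_eq_zero {p : MvPolynomial σ F} (hp : p ∈ polyGrading F σ 2) :
    MvPolynomial.constantCoeff p = 0 := by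
  by_contra h
  have h' : Finsupp.weight (fun _ : σ => (2 : ℤ)) 0 = 2 := hp h
  simp at h'

/-- Linearly independent linear forms become distinct variables after a linear change of
coordinates. -/
theorem exists_algEquiv_X {ι : Type*} (x : ι → MvPolynomial σ F)
    (hdeg : ∀ i, x i ∈ polyGrading F σ 2) (hx : LinearIndependent F x) :
    ∃ (t : ι → σ) (e : MvPolynomial σ F ≃ₐ[F] MvPolynomial σ F),
      Function.Injective t ∧ ∀ i, e (MvPolynomial.X (t i)) = x i := by
  classical
  choose v hv using fun i => exists_linearCombination_X (hdeg i)
  set L := Finsupp.linearCombination F (MvPolynomial.X : σ → MvPolynomial σ F) with hL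
  have hvi : LinearIndependent F v := by
    refine LinearIndependent.of_comp L ?_
    have : L ∘ v = x := funext hv
    rwa [this]
  -- Extend the coefficient vectors to a basis, index it by the variables, and let the algebra
  -- automorphism act on linear forms by this change of basis.
  let b := Module.Basis.sumExtend hvi
  let E := b.indexEquiv (Finsupp.basisSingleOne (R := F) (ι := σ))
  let f : (σ →₀ F) ≃ₗ[F] (σ →₀ F) := (b.reindex E).repr.symm
  let A : ((σ →₀ F) →ₗ[F] (σ →₀ F)) → (MvPolynomial σ F →ₐ[F] MvPolynomial σ F) :=
    fun g => MvPolynomial.aeval fun s => L (g (Finsupp.single s 1))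
  have hA : ∀ g v, A g (L v) = L (g v) := by
    intro g v
    have : (A g).toLinearMap ∘ₗ L = L ∘ₗ g := by
      refine Finsupp.lhom_ext' fun s => LinearMap.ext_ring ?_
      simp [A, hL]
    exact LinearMap.congr_fun this v
  have hX : ∀ s, (MvPolynomial.X s : MvPolynomial σ F) = L (Finsupp.single s 1) := by
    intro s; simp [hL]
  refine ⟨fun i => E (Sum.inl i), AlgEquiv.ofAlgHom (A f) (A f.symm) ?_ ?_, ?_, ?_⟩
  · refine MvPolynomial.algHom_ext fun s => ?_
    rw [AlgHom.comp_apply, hX, hA, hA]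
    simp
  · refine MvPolynomial.algHom_ext fun s => ?_
    rw [AlgHom.comp_apply, hX, hA, hA]
    simp
  · exact E.injective.comp Sum.inl_injective
  · intro i
    rw [AlgEquiv.ofAlgHom_apply, hX, hA]
    have : f (Finsupp.single (E (Sum.inl i)) 1) = v i := by
      simp only [f, Module.Basis.repr_symm_single_one, Module.Basis.reindex_apply,
        Equiv.symm_apply_apply]
      simp only [b, Module.Basis.sumExtend, Module.Basis.reindex_apply,
        Module.Basis.extend_apply_self]
      rfl
    rw [LinearEquiv.coe_coe, this, hv]

/-- The ideal is monomial: a variable of `s` dividing `X_j` times a monomial already divides the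
monomial. -/
theorem mem_span_X_of_X_mul_mem {s : Set σ} {j : σ} (hj : j ∉ s) {p : MvPolynomial σ F}
    (h : MvPolynomial.X j * p ∈ Ideal.span (MvPolynomial.X '' s : Set (MvPolynomial σ F))) :
    p ∈ Ideal.span (MvPolynomial.X '' s : Set (MvPolynomial σ F)) := by
  rw [MvPolynomial.mem_ideal_span_X_image] at h ⊢
  intro m hm
  obtain ⟨i, hi, hne⟩ := h (Finsupp.single j 1 + m) (by
    rwa [MvPolynomial.mem_support_iff, MvPolynomial.coeff_X_mul, ← MvPolynomial.mem_support_iff])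
  have hij : j ≠ i := fun h => hj (h ▸ hi)
  refine ⟨i, hi, ?_⟩
  rwa [Finsupp.add_apply, Finsupp.single_eq_of_ne' hij, zero_add] at hne

/-- A family of linearly independent linear forms is a regular sequence in any order. -/
theorem mem_span_of_mul_mem {ι : Type*} {x : ι → MvPolynomial σ F}
    (hdeg : ∀ i, x i ∈ polyGrading F σ 2) (hx : LinearIndependent F x)
    {s : Set ι} {j : ι} (hj : j ∉ s) {p : MvPolynomial σ F}
    (h : x j * p ∈ Ideal.span (x '' s)) : p ∈ Ideal.span (x '' s) := by
  obtain ⟨t, e, ht, he⟩ := exists_algEquiv_X x hdeg hx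
  have hs : Ideal.span (x '' s) =
      (Ideal.span (MvPolynomial.X '' (t '' s) : Set (MvPolynomial σ F))).comap
        e.toRingEquiv.symm := by
    rw [Ideal.comap_symm, Ideal.map_span, Set.image_image, Set.image_image]
    exact congrArg Ideal.span (Set.image_congr fun i _ => (he i).symm)
  rw [hs, Ideal.mem_comap] at h ⊢
  refine mem_span_X_of_X_mul_mem (j := t j) ?_ ?_
  · rwa [ht.mem_set_image]
  · rw [map_mul, ← he j] at h
    rwa [show e.toRingEquiv.symm (e (MvPolynomial.X (t j))) = MvPolynomial.X (t j) from
      e.symm_apply_apply _] at h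

theorem one_notMem_span {ι : Type*} {x : ι → MvPolynomial σ F}
    (hdeg : ∀ i, x i ∈ polyGrading F σ 2) : (1 : MvPolynomial σ F) ∉ Ideal.span (Set.range x) := by
  intro h
  have hle : Ideal.span (Set.range x) ≤
      RingHom.ker (MvPolynomial.constantCoeff : MvPolynomial σ F →+* F) := by
    rw [Ideal.span_le]
    rintro _ ⟨i, rfl⟩
    exact constantCoeff_eq_zero (hdeg i)
  simpa using hle h

theorem isWeaklyRegular_ofFn {n : ℕ} {x : Fin n → MvPolynomial σ F}
    (hdeg : ∀ i, x i ∈ polyGrading F σ 2) (hx : LinearIndependent F x) :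
    RingTheory.Sequence.IsWeaklyRegular (MvPolynomial σ F) (List.ofFn x) := by
  refine ⟨fun i hi => ?_⟩
  have hin : i < n := by simpa using hi
  have hset : {r | r ∈ (List.ofFn x).take i} = x '' {k | k.val < i} := by
    ext r
    rw [Set.mem_ofPred_eq, List.mem_take_iff_getElem]
    constructor
    · rintro ⟨k, hk, rfl⟩
      have hk' : k < n := by rw [List.length_ofFn] at hk; lia
      exact ⟨⟨k, hk'⟩, show k < i by lia, by rw [List.getElem_ofFn]⟩
    · rintro ⟨k, hk, rfl⟩
      have hk' : k.val < i := hk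
      exact ⟨k.val, by rw [List.length_ofFn]; lia, by rw [List.getElem_ofFn]⟩
  have hI : (Ideal.ofList ((List.ofFn x).take i) • ⊤ : Submodule (MvPolynomial σ F)
      (MvPolynomial σ F)) = Ideal.span (x '' {k | k.val < i}) := by
    rw [Ideal.smul_top_eq_map, Ideal.ofList, hset]
    simp
  rw [isSMulRegular_quotient_iff_mem_of_smul_mem, hI]
  intro p hp
  rw [List.getElem_ofFn, smul_eq_mul] at hp
  exact mem_span_of_mul_mem hdeg hx (j := ⟨i, hin⟩) (by simp) hp

end LinearForms

end StringModule

namespace StringModule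

/-! ### Projective dimension and Ext modulo a regular sequence. -/

section ProjectiveDimension

universe u

open Abelian RingTheory.Sequence

variable {R : Type u} [CommRing R]

/-- Each regular element `r` gives `0 → M → M → M/rM → 0`, which raises the bound by at most one. -/
theorem hasProjectiveDimensionLT_quotient (rs : List R) (M : ModuleCat.{u} R)
    (reg : IsWeaklyRegular M rs) (k : ℕ) (hM : HasProjectiveDimensionLT M k) :
    HasProjectiveDimensionLT
      (ModuleCat.of R (M ⧸ (Ideal.ofList rs • ⊤ : Submodule R M))) (k + rs.length) := by
  induction rs generalizing M k with
  | nil =>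
    refine hasProjectiveDimensionLT_of_iso (X := M) (LinearEquiv.toModuleIso ?_) k
    exact (Submodule.quotEquivOfEqBot _ (by simp)).symm
  | cons r rs ih =>
    rw [isWeaklyRegular_cons_iff] at reg
    have hS := reg.1.smulShortComplex_shortExact
    have h1 : HasProjectiveDimensionLT (ModuleCat.of R (QuotSMulTop r M)) (k + 1) :=
      hS.hasProjectiveDimensionLT_X₃ k hM (hasProjectiveDimensionLT_of_ge M k (k + 1) (by lia))
    have h2 := ih (ModuleCat.of R (QuotSMulTop r M)) reg.2 (k + 1) h1
    rw [List.length_cons, add_comm rs.length, ← add_assoc]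
    exact hasProjectiveDimensionLT_of_iso
      (Submodule.quotOfListConsSMulTopEquivQuotSMulTopInner M r rs).symm.toModuleIso _

/-- The lower bound: since each `r` kills `N`, multiplication by `r` is zero on Ext into `N`, so the
connecting map embeds `Ext^k(M, N)` in `Ext^{k+1}(M/rM, N)`. -/
theorem nontrivial_ext_quotient (rs : List R) (M N : ModuleCat.{u} R)
    (reg : IsWeaklyRegular M rs) (hN : ∀ r ∈ rs, r ∈ Module.annihilator R N) (k : ℕ)
    (hM : Nontrivial (Ext M N k)) :
    Nontrivial (Ext (ModuleCat.of R (M ⧸ (Ideal.ofList rs • ⊤ : Submodule R M))) N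
      (k + rs.length)) := by
  induction rs generalizing M k with
  | nil =>
    let e : M ≅ ModuleCat.of R (M ⧸ (Ideal.ofList ([] : List R) • ⊤ : Submodule R M)) :=
      LinearEquiv.toModuleIso (Submodule.quotEquivOfEqBot _ (by simp)).symm
    have hinj : Function.Injective
        (fun y : Ext M N k => (Ext.mk₀ e.inv).comp y (zero_add k)) := by
      intro y z hyz
      have := congrArg (fun w => (Ext.mk₀ e.hom).comp w (zero_add k)) hyz
      simpa using this
    exact hinj.nontrivial
  | cons r rs ih =>
    rw [isWeaklyRegular_cons_iff] at reg
    have hS := reg.1.smulShortComplex_shortExact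
    have h1 : Nontrivial (Ext (ModuleCat.of R (QuotSMulTop r M)) N (k + 1)) := by
      have hinj : Function.Injective
          (hS.extClass.precomp N (add_comm 1 k)) := by
        rw [injective_iff_map_eq_zero]
        intro y hy
        obtain ⟨w, rfl⟩ := Ext.contravariant_sequence_exact₁ hS N y (add_comm 1 k) hy
        have hz : r • 𝟙 N = 0 := by
          rw [← ModuleCat.lsmul_eq_smul_id,
            Module.mem_annihilator_iff_lsmul_eq_zero.mp (hN r (by simp))]
          rfl
        -- The action of `r` through the source agrees with its action through the target, where it
        -- is zero.
        have e1 (v : Ext M N k) : (Ext.mk₀ (r • 𝟙 M)).comp v (zero_add k) = r • v := by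
          rw [Ext.mk₀_smul, Ext.smul_comp, Ext.mk₀_id_comp]
        have e2 (v : Ext M N k) : v.comp (Ext.mk₀ (r • 𝟙 N)) (add_zero k) = r • v := by
          rw [Ext.mk₀_smul, Ext.comp_smul, Ext.comp_mk₀_id]
        have e3 (v : Ext M N k) : (Ext.mk₀ (r • 𝟙 M)).comp v (zero_add k) = 0 := by
          rw [e1, ← e2, hz, Ext.mk₀_zero, Ext.comp_zero]
        exact e3 w
      exact @Function.Injective.nontrivial _ _ hM _ hinj
    have h2 := ih (ModuleCat.of R (QuotSMulTop r M)) reg.2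
      (fun s hs => hN s (List.mem_cons_of_mem _ hs)) (k + 1) h1
    rw [List.length_cons, add_comm rs.length, ← add_assoc]
    let e : ModuleCat.of R (M ⧸ (Ideal.ofList (r :: rs) • ⊤ : Submodule R M)) ≅
        ModuleCat.of R (QuotSMulTop r M ⧸ (Ideal.ofList rs • ⊤ : Submodule R (QuotSMulTop r M))) :=
      (Submodule.quotOfListConsSMulTopEquivQuotSMulTopInner M r rs).toModuleIso
    have hinj : Function.Injective
        (fun y : Ext _ N (k + 1 + rs.length) =>
          (Ext.mk₀ e.hom).comp y (zero_add _)) := by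
      intro y z hyz
      have := congrArg (fun w => (Ext.mk₀ e.inv).comp w (zero_add _)) hyz
      simpa using this
    exact hinj.nontrivial

end ProjectiveDimension

end StringModule

namespace StringModule

/-! ### Functionals on the syzygies of a regular sequence. -/

section Syzygies

variable {R ι : Type*} [CommRing R]

theorem dvd_of_dvd_mul {x : ι → R}
    (hreg : ∀ (s : Set ι) (j : ι), j ∉ s → ∀ p, x j * p ∈ Ideal.span (x '' s) →
      p ∈ Ideal.span (x '' s)) {i j : ι} (hij : j ≠ i) {p : R} (h : x i ∣ x j * p) :
    x i ∣ p := by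
  have := hreg {i} j (by simpa using hij) p
  rw [Set.image_singleton, Ideal.mem_span_singleton, Ideal.mem_span_singleton] at this
  exact this h

variable [Fintype ι]

/-- The Koszul syzygy on the pair `i, j`. -/
def koszulSyzygy [DecidableEq ι] (x : ι → R) (i j : ι) :
    LinearMap.ker (Fintype.linearCombination R x) :=
  ⟨Pi.single j (x i) - Pi.single i (x j), by
    rw [LinearMap.mem_ker, map_sub, Fintype.linearCombination_apply_single,
      Fintype.linearCombination_apply_single, smul_eq_mul, smul_eq_mul, mul_comm, sub_self]⟩

/-- For a syzygy `h`, `x_a h` is the combination of the Koszul syzygies at `a` with coefficients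
`h_i`; so `φ` extends to the free module after multiplication by `x_a`. -/
theorem mul_apply_syzygy [DecidableEq ι] {x : ι → R} (a : ι)
    (φ : LinearMap.ker (Fintype.linearCombination R x) →ₗ[R] R)
    (h : LinearMap.ker (Fintype.linearCombination R x)) :
    x a * φ h = ∑ i, φ (koszulSyzygy x a i) * h.1 i := by
  have hh : x a • h = ∑ i, h.1 i • koszulSyzygy x a i := by
    have h0 : ∑ i, h.1 i * x i = 0 := h.2
    ext k
    simp only [koszulSyzygy, Submodule.coe_smul, Pi.smul_apply, smul_eq_mul, Submodule.coe_sum,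
      Finset.sum_apply, Pi.sub_apply, mul_sub, Finset.sum_sub_distrib, Pi.single_apply, mul_ite,
      mul_zero, Finset.sum_ite_eq, Finset.mem_univ, if_true]
    split_ifs
    · rw [h0, sub_zero, mul_comm]
    · rw [Finset.sum_const_zero, sub_zero, mul_comm]
  rw [← smul_eq_mul, ← map_smul, hh, map_sum]
  exact Finset.sum_congr rfl fun i _ => by rw [map_smul, smul_eq_mul, mul_comm]

variable [IsDomain R]

/-- A functional vanishing on all syzygies of `x` is a multiple of `x`. -/
theorem exists_eq_smul_of_forall_syzygy {x : ι → R} (hx : ∀ i, x i ≠ 0)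
    (hreg : ∀ (s : Set ι) (j : ι), j ∉ s → ∀ p, x j * p ∈ Ideal.span (x '' s) →
      p ∈ Ideal.span (x '' s)) {a b : ι} (hab : b ≠ a) (c : ι → R)
    (hc : ∀ h ∈ LinearMap.ker (Fintype.linearCombination R x), ∑ i, c i * h i = 0) :
    ∃ r : R, c = r • x := by
  classical
  have key : ∀ i j, x i * c j = x j * c i := by
    intro i j
    have h := hc _ (koszulSyzygy x i j).2
    simp only [koszulSyzygy, Pi.sub_apply, mul_sub, Finset.sum_sub_distrib, Pi.single_apply,
      mul_ite, mul_zero, Finset.sum_ite_eq', Finset.mem_univ, if_true] at h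
    linear_combination h
  obtain ⟨r, hr⟩ := dvd_of_dvd_mul hreg hab (Dvd.intro _ (key a b))
  refine ⟨r, funext fun j => mul_left_cancel₀ (hx a) ?_⟩
  rw [key, hr, Pi.smul_apply, smul_eq_mul]
  ring

/-- Every functional on the syzygies of a regular sequence of length at least three extends to the
ambient free module. -/
theorem exists_forall_syzygy_eq {x : ι → R} (hx : ∀ i, x i ≠ 0)
    (hreg : ∀ (s : Set ι) (j : ι), j ∉ s → ∀ p, x j * p ∈ Ideal.span (x '' s) →
      p ∈ Ideal.span (x '' s)) {a b c : ι} (hab : b ≠ a) (hac : c ≠ a) (hbc : c ≠ b)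
    (φ : LinearMap.ker (Fintype.linearCombination R x) →ₗ[R] R) :
    ∃ d : ι → R, ∀ h, φ h = ∑ i, d i * h.1 i := by
  classical
  set u : ι → R := fun i => φ (koszulSyzygy x a i) with hu
  set v : ι → R := fun i => φ (koszulSyzygy x b i) with hv
  -- Both `u / x_a` and `v / x_b` represent `φ` over the fraction field, so `x_b u - x_a v` kills
  -- all syzygies.
  obtain ⟨r, hr⟩ := exists_eq_smul_of_forall_syzygy hx hreg hab
    (fun i => x b * u i - x a * v i) (by
      intro h hh
      have h1 := mul_apply_syzygy a φ ⟨h, hh⟩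
      have h2 := mul_apply_syzygy b φ ⟨h, hh⟩
      simp only [sub_mul, Finset.sum_sub_distrib, mul_assoc, ← Finset.mul_sum]
      simp only [hu, hv]
      rw [← h1, ← h2]
      ring)
  have hr' : ∀ i, x b * u i - x a * v i = r * x i := fun i => congrFun hr i
  -- The coordinate at the third index `c` puts `r x_c`, hence `r`, in `(x_a, x_b)`.
  have hmem : r ∈ Ideal.span (x '' {a, b}) := by
    refine hreg {a, b} c (by simp [hac, hbc]) r ?_
    rw [Set.image_pair, Ideal.mem_span_pair]
    exact ⟨-v c, u c, by linear_combination hr' c⟩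
  rw [Set.image_pair, Ideal.mem_span_pair] at hmem
  obtain ⟨s', s, hs⟩ := hmem
  -- Subtracting `s x` does not change the functional on syzygies and makes `u` divisible by `x_a`;
  -- the quotient `d` extends `φ`.
  have hd : ∀ i, x a ∣ u i - s * x i := fun i =>
    dvd_of_dvd_mul hreg hab ⟨v i + s' * x i, by linear_combination hr' i - x i * hs⟩
  choose d hd using hd
  refine ⟨d, fun h => mul_left_cancel₀ (hx a) ?_⟩
  have h0 : ∑ i, h.1 i * x i = 0 := h.2
  have hsum : ∑ i, u i * h.1 i = s * ∑ i, h.1 i * x i + x a * ∑ i, d i * h.1 i := by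
    rw [Finset.mul_sum, Finset.mul_sum, ← Finset.sum_add_distrib]
    exact Finset.sum_congr rfl fun i _ => by linear_combination h.1 i * hd i
  rw [mul_apply_syzygy a φ h, hsum, h0, mul_zero, zero_add]

end Syzygies

/-! ### The string module as a syzygy module. -/

section Differences

variable {R : Type*} [CommRing R] {m : ℕ}

/-- The successive differences `f_j - f_{j-1}`, where `f` is extended by `0` on both sides. -/
def difference : (Fin (m + 1) → R) →ₗ[R] (Fin (m + 2) → R) where
  toFun f j := (Fin.snoc f 0 : Fin (m + 2) → R) j - (Fin.cons 0 f : Fin (m + 2) → R) j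
  map_add' f g := by
    ext j
    have h1 : (Fin.snoc (f + g) 0 : Fin (m + 2) → R) = Fin.snoc f 0 + Fin.snoc g 0 := by
      ext k; refine Fin.lastCases ?_ (fun k => ?_) k <;> simp
    have h2 : (Fin.cons 0 (f + g) : Fin (m + 2) → R) = Fin.cons 0 f + Fin.cons 0 g := by
      ext k; refine Fin.cases ?_ (fun k => ?_) k <;> simp
    rw [h1, h2]
    exact add_sub_add_comm _ _ _ _
  map_smul' r f := by
    ext j
    have h1 : (Fin.snoc (r • f) 0 : Fin (m + 2) → R) = r • Fin.snoc f 0 := by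
      ext k; refine Fin.lastCases ?_ (fun k => ?_) k <;> simp
    have h2 : (Fin.cons 0 (r • f) : Fin (m + 2) → R) = r • Fin.cons 0 f := by
      ext k; refine Fin.cases ?_ (fun k => ?_) k <;> simp
    rw [h1, h2]
    exact (smul_sub r _ _).symm

theorem difference_zero (f : Fin (m + 1) → R) : difference f 0 = f 0 := by
  change (Fin.snoc f 0 : Fin (m + 2) → R) (Fin.castSucc 0) - (Fin.cons 0 f : Fin (m + 2) → R) 0 = _
  rw [Fin.snoc_castSucc, Fin.cons_zero, sub_zero]

theorem difference_last (f : Fin (m + 1) → R) :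
    difference f (Fin.last (m + 1)) = -f (Fin.last m) := by
  change (Fin.snoc f 0 : Fin (m + 2) → R) (Fin.last (m + 1)) -
    (Fin.cons 0 f : Fin (m + 2) → R) (Fin.last m).succ = _
  rw [Fin.snoc_last, Fin.cons_succ, zero_sub]

theorem difference_succ_castSucc (f : Fin (m + 1) → R) (i : Fin m) :
    difference f i.succ.castSucc = f i.succ - f i.castSucc := by
  change (Fin.snoc f 0 : Fin (m + 2) → R) i.succ.castSucc -
    (Fin.cons 0 f : Fin (m + 2) → R) i.castSucc.succ = _
  rw [Fin.snoc_castSucc, Fin.cons_succ]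

theorem sum_difference (f : Fin (m + 1) → R) : ∑ j, difference f j = 0 := by
  change ∑ j, ((Fin.snoc f 0 : Fin (m + 2) → R) j - (Fin.cons 0 f : Fin (m + 2) → R) j) = 0
  rw [Finset.sum_sub_distrib, Fin.sum_univ_castSucc,
    Fin.sum_univ_succ (Fin.cons 0 f : Fin (m + 2) → R)]
  simp only [Fin.snoc_castSucc, Fin.snoc_last, Fin.cons_zero, Fin.cons_succ, add_zero, zero_add,
    sub_self]

theorem difference_injective : Function.Injective (difference (R := R) (m := m)) := by
  rw [injective_iff_map_eq_zero]
  intro f hf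
  ext i
  induction i using Fin.induction with
  | zero => rw [← difference_zero f, hf]; rfl
  | succ i ih =>
    have h := difference_succ_castSucc f i
    rw [hf, ih, Pi.zero_apply, Pi.zero_apply, sub_zero] at h
    exact h.symm

theorem exists_difference_eq {g : Fin (m + 2) → R} (hg : ∑ j, g j = 0) :
    ∃ f, difference f = g := by
  have h0 : Fin.partialSum g 0 = 0 := Fin.partialSum_zero g
  have hl : Fin.partialSum g (Fin.last (m + 2)) = 0 := by
    rw [← hg, Fin.partialSum, Fin.val_last, List.take_of_length_le (by simp), List.sum_ofFn]
  have hs := Fin.partialSum_succ g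
  -- The witness is `f_i = g_0 + ⋯ + g_i`; the empty and the full sums vanish, matching the padding.
  refine ⟨fun i => Fin.partialSum g i.succ.castSucc, funext fun j => ?_⟩
  have e1 : (Fin.snoc (fun i : Fin (m + 1) => Fin.partialSum g i.succ.castSucc) 0 :
      Fin (m + 2) → R) j = Fin.partialSum g j.succ := by
    refine Fin.lastCases ?_ (fun k => ?_) j
    · rw [Fin.snoc_last]; exact hl.symm
    · rw [Fin.snoc_castSucc]; rfl
  have e2 : (Fin.cons 0 (fun i : Fin (m + 1) => Fin.partialSum g i.succ.castSucc) :
      Fin (m + 2) → R) j = Fin.partialSum g j.castSucc := by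
    refine Fin.cases ?_ (fun k => ?_) j
    · rw [Fin.cons_zero]; exact h0.symm
    · rw [Fin.cons_succ]
  change (Fin.snoc _ 0 : Fin (m + 2) → R) j - (Fin.cons 0 _ : Fin (m + 2) → R) j = _
  rw [e1, e2, hs, add_sub_cancel_left]

theorem mem_stringModule_iff {x : Fin (m + 2) → R} {f : Fin (m + 1) → R} :
    f ∈ stringModule x ↔ ∀ j, x j ∣ difference f j := by
  constructor
  · rintro ⟨h0, hl, h⟩ j
    refine Fin.lastCases ?_ (fun j => ?_) j
    · rw [difference_last]; exact (dvd_neg).2 hl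
    · refine Fin.cases ?_ (fun i => ?_) j
      · rw [Fin.castSucc_zero, difference_zero]; exact h0
      · rw [difference_succ_castSucc]; exact h i
  · intro h
    refine ⟨?_, ?_, fun i => ?_⟩
    · rw [← difference_zero f]; exact h 0
    · rw [← dvd_neg, ← difference_last f]; exact h _
    · rw [← difference_succ_castSucc]; exact h _

variable [IsDomain R]

/-- The coefficients `h_j` with `x_j h_j = f_j - f_{j-1}` of an element of the string module. -/
noncomputable def coefficients (x : Fin (m + 2) → R) (hx : ∀ j, x j ≠ 0) :
    stringModule x →ₗ[R] (Fin (m + 2) → R) where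
  toFun f j := (mem_stringModule_iff.1 f.2 j).choose
  map_add' f g := by
    ext j
    refine mul_left_cancel₀ (hx j) ?_
    rw [Pi.add_apply, mul_add, ← (mem_stringModule_iff.1 (f + g).2 j).choose_spec,
      ← (mem_stringModule_iff.1 f.2 j).choose_spec, ← (mem_stringModule_iff.1 g.2 j).choose_spec,
      Submodule.coe_add, map_add, Pi.add_apply]
  map_smul' r f := by
    ext j
    refine mul_left_cancel₀ (hx j) ?_
    rw [RingHom.id_apply, Pi.smul_apply, smul_eq_mul, mul_left_comm,
      ← (mem_stringModule_iff.1 (r • f).2 j).choose_spec,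
      ← (mem_stringModule_iff.1 f.2 j).choose_spec, Submodule.coe_smul, map_smul, Pi.smul_apply,
      smul_eq_mul]

variable {x : Fin (m + 2) → R} (hx : ∀ j, x j ≠ 0)

theorem mul_coefficients (f : stringModule x) (j : Fin (m + 2)) :
    x j * coefficients x hx f j = difference f.1 j :=
  (mem_stringModule_iff.1 f.2 j).choose_spec.symm

theorem coefficients_injective : Function.Injective (coefficients x hx) := by
  intro f g hfg
  refine Subtype.ext (difference_injective (funext fun j => ?_))
  rw [← mul_coefficients hx, ← mul_coefficients hx, hfg]

theorem range_coefficients :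
    LinearMap.range (coefficients x hx) = LinearMap.ker (Fintype.linearCombination R x) := by
  ext h
  constructor
  · rintro ⟨f, rfl⟩
    rw [LinearMap.mem_ker, Fintype.linearCombination_apply, ← sum_difference f.1]
    exact Finset.sum_congr rfl fun j _ => by rw [← mul_coefficients hx, smul_eq_mul, mul_comm]
  · intro hh
    rw [LinearMap.mem_ker, Fintype.linearCombination_apply] at hh
    obtain ⟨f, hf⟩ := exists_difference_eq (g := fun j => h j * x j) hh
    refine ⟨⟨f, mem_stringModule_iff.2 fun j => ?_⟩, funext fun j => mul_left_cancel₀ (hx j) ?_⟩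
    · rw [hf]; exact Dvd.intro_left _ rfl
    · rw [mul_coefficients, hf, mul_comm]

end Differences

end StringModule

namespace StringModule

/-! ### The projective dimension of the string module. -/

section StringProjectiveDimension

universe u

theorem shortExact_moduleCatMk {R M₁ M₂ M₃ : Type u} [CommRing R]
    [AddCommGroup M₁] [AddCommGroup M₂] [AddCommGroup M₃] [Module R M₁] [Module R M₂] [Module R M₃]
    {f : M₁ →ₗ[R] M₂} {g : M₂ →ₗ[R] M₃} (hf : Function.Injective f) (hfg : Function.Exact f g)
    (hg : Function.Surjective g) :
    (ShortComplex.moduleCatMk f g hfg.linearMap_comp_eq_zero).ShortExact :=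
  ModuleCat.shortComplex_shortExact _ hfg hf hg

variable {R : Type u} [CommRing R]

theorem hasProjectiveDimensionLT_of_projective (M : Type u) [AddCommGroup M] [Module R M]
    [Module.Projective R M] (k : ℕ) :
    HasProjectiveDimensionLT (ModuleCat.of R M) (k + 1) := by
  have : Projective (ModuleCat.of R M) := (IsProjective.iff_projective M).1 inferInstance
  exact hasProjectiveDimensionLT_of_ge _ 1 _ (by lia)

theorem hasProjectiveDimensionLT_quotient_span {n : ℕ} {x : Fin n → R}
    (reg : RingTheory.Sequence.IsWeaklyRegular R (List.ofFn x)) :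
    HasProjectiveDimensionLT (ModuleCat.of R (R ⧸ Ideal.span (Set.range x))) (n + 1) := by
  have h := hasProjectiveDimensionLT_quotient (List.ofFn x) (ModuleCat.of R R) reg 1
    (hasProjectiveDimensionLT_of_projective R 0)
  rw [List.length_ofFn, add_comm] at h
  refine @hasProjectiveDimensionLT_of_iso _ _ _ _ _ (LinearEquiv.toModuleIso
    (Submodule.quotEquivOfEq _ _ ?_)) _ h
  simp [Ideal.ofList, List.mem_ofFn, Set.range]

/-- `Hom(R, R/I)` is nonzero because `I` is proper, and `n` regular elements carry it into
`Ext^n(R/I, R/I)`. -/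
theorem not_hasProjectiveDimensionLT_quotient_span {n : ℕ} {x : Fin n → R}
    (reg : RingTheory.Sequence.IsWeaklyRegular R (List.ofFn x))
    (hx : (1 : R) ∉ Ideal.span (Set.range x)) :
    ¬ HasProjectiveDimensionLT (ModuleCat.of R (R ⧸ Ideal.span (Set.range x))) n := by
  intro h
  set I := Ideal.span (Set.range x) with hI
  have : Nontrivial (R ⧸ I) := Ideal.Quotient.nontrivial_iff.2 fun h => hx (by rw [h]; trivial)
  let N := ModuleCat.of R (R ⧸ I)
  have h0 : Nontrivial (Abelian.Ext (ModuleCat.of R R) N 0) := by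
    refine (Abelian.Ext.addEquiv₀.trans ModuleCat.homAddEquiv).toEquiv.nontrivial_congr.2 ?_
    exact (LinearMap.ringLmapEquivSelf R ℕ (R ⧸ I)).toEquiv.nontrivial
  have h1 := nontrivial_ext_quotient (List.ofFn x) (ModuleCat.of R R) N reg (by
    intro r hr
    rw [Ideal.annihilator_quotient]
    refine Ideal.subset_span ?_
    rwa [List.mem_ofFn] at hr) 0 h0
  rw [List.length_ofFn, zero_add] at h1
  have e : (R ⧸ (Ideal.ofList (List.ofFn x) • ⊤ : Submodule R R)) ≃ₗ[R] (R ⧸ I) :=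
    Submodule.quotEquivOfEq _ _ (by simp [hI, Ideal.ofList, List.mem_ofFn, Set.range])
  have h2 := @hasProjectiveDimensionLT_of_iso _ _ _ _ _ e.symm.toModuleIso _ h
  exact not_subsingleton_iff_nontrivial.2 h1
    (HasProjectiveDimensionLT.subsingleton _ n n le_rfl N)

theorem projectiveDimension_stringModule [IsDomain R] {m : ℕ} {x : Fin (m + 2) → R}
    (hx : ∀ j, x j ≠ 0) (reg : RingTheory.Sequence.IsWeaklyRegular R (List.ofFn x))
    (hx1 : (1 : R) ∉ Ideal.span (Set.range x)) :
    projectiveDimension (ModuleCat.of R (stringModule x)) = (m : WithBot ℕ∞) := by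
  set I := Ideal.span (Set.range x) with hI
  have hIr : LinearMap.range (Fintype.linearCombination R x) = I :=
    Fintype.range_linearCombination R x
  let g : (Fin (m + 2) → R) →ₗ[R] I := LinearMap.codRestrict I (Fintype.linearCombination R x)
    fun h => hIr ▸ LinearMap.mem_range_self _ h
  have hg : Function.Surjective g := by
    rintro ⟨y, hy⟩
    rw [← hIr] at hy
    obtain ⟨h, rfl⟩ := hy
    exact ⟨h, rfl⟩
  have hfg : Function.Exact (coefficients x hx) g := by
    rw [LinearMap.exact_iff, range_coefficients, LinearMap.ker_codRestrict]
  have h1 := shortExact_moduleCatMk (coefficients_injective hx) hfg hg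
  have h2 := shortExact_moduleCatMk I.injective_subtype (LinearMap.exact_subtype_mkQ I)
    I.mkQ_surjective
  refine le_antisymm ?_ ?_
  -- Here `n = m + 2`. The strict bounds are `m + 3` for `R/I`, `m + 2` for `I` and `m + 1` for the
  -- string module.
  · rw [projectiveDimension_le_iff]
    exact h1.hasProjectiveDimensionLT_X₁ (m + 1) (hasProjectiveDimensionLT_of_projective _ m)
      (h2.hasProjectiveDimensionLT_X₁ (m + 2) (hasProjectiveDimensionLT_of_projective _ (m + 1))
        (hasProjectiveDimensionLT_quotient_span reg))
  · rw [projectiveDimension_ge_iff]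
    intro h
    exact not_hasProjectiveDimensionLT_quotient_span reg hx1
      (h2.hasProjectiveDimensionLT_X₃ (m + 1) (h1.hasProjectiveDimensionLT_X₃ m h
        (hasProjectiveDimensionLT_of_projective _ m))
        (hasProjectiveDimensionLT_of_projective _ (m + 1)))

end StringProjectiveDimension

/-! ### The graded dual and its presentation. -/

section GradedDual

variable {F σ : Type*} [Field F]

theorem mul_mem_polyGrading {j k : ℤ} {p q : MvPolynomial σ F} (hp : p ∈ polyGrading F σ j)
    (hq : q ∈ polyGrading F σ k) : p * q ∈ polyGrading F σ (j + k) :=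
  MvPolynomial.IsWeightedHomogeneous.mul hp hq

/-- The degree `j + k` component of `p q` is `p` times the degree `k` component of `q`; then `p`
cancels. -/
theorem mem_polyGrading_of_mul_mem {j k : ℤ} {p q : MvPolynomial σ F} (hp0 : p ≠ 0)
    (hp : p ∈ polyGrading F σ j) (hpq : p * q ∈ polyGrading F σ (j + k)) :
    q ∈ polyGrading F σ k := by
  let w : σ → ℤ := fun _ => 2
  let := MvPolynomial.weightedGradedAlgebra F w
  have h := DirectSum.coe_decompose_mul_add_of_left_mem
    (MvPolynomial.weightedHomogeneousSubmodule F w) (j := k) (b := q) hp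
  rw [DirectSum.decompose_of_mem_same _
    (show p * q ∈ MvPolynomial.weightedHomogeneousSubmodule F w (j + k) from hpq)] at h
  rw [mul_left_cancel₀ hp0 h]
  exact (DirectSum.decompose (MvPolynomial.weightedHomogeneousSubmodule F w) q k).2

theorem difference_mem {m : ℕ} {d : ℤ} {f : Fin (m + 1) → MvPolynomial σ F}
    (hf : ∀ i, f i ∈ polyGrading F σ d) (j : Fin (m + 2)) :
    difference f j ∈ polyGrading F σ d := by
  refine Fin.lastCases ?_ (fun j => ?_) j
  · rw [difference_last]; exact neg_mem (hf _)
  · refine Fin.cases ?_ (fun i => ?_) j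
    · rw [Fin.castSucc_zero, difference_zero]; exact hf 0
    · rw [difference_succ_castSucc]; exact sub_mem (hf _) (hf _)

variable {m : ℕ} {x : Fin (m + 2) → MvPolynomial σ F} (hx : ∀ j, x j ≠ 0)

theorem coefficients_mem (hdeg : ∀ i, x i ∈ polyGrading F σ 2) {d : ℤ} {f : stringModule x}
    (hf : f ∈ stringGrading x d) (j : Fin (m + 2)) :
    coefficients x hx f j ∈ polyGrading F σ (-2 + d) := by
  refine mem_polyGrading_of_mul_mem (hx j) (hdeg j) ?_
  rw [mul_coefficients, add_neg_cancel_left]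
  exact difference_mem (fun i => hf i trivial) j

theorem proj_coefficients_mem_homDegree (hdeg : ∀ i, x i ∈ polyGrading F σ 2) (j : Fin (m + 2)) :
    LinearMap.proj j ∘ₗ coefficients x hx ∈ homDegree (stringGrading x) (polyGrading F σ) (-2) :=
  fun _ _ hf => coefficients_mem hx hdeg hf j

theorem linearCombination_proj_coefficients_apply (c : Fin (m + 2) → MvPolynomial σ F)
    (f : stringModule x) :
    Fintype.linearCombination (MvPolynomial σ F)
      (fun j => LinearMap.proj j ∘ₗ coefficients x hx) c f = ∑ j, c j * coefficients x hx f j := by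
  rw [Fintype.linearCombination_apply, LinearMap.sum_apply]
  rfl

/-- The map `R^n → St^∨` sending `c` to the restriction of `h ↦ ∑ c_j h_j`. -/
noncomputable def toGradedDual (hdeg : ∀ i, x i ∈ polyGrading F σ 2) :
    (Fin (m + 2) → MvPolynomial σ F) →ₗ[MvPolynomial σ F]
      gradedDual (F := F) (σ := σ) (stringGrading x) :=
  LinearMap.codRestrict _ (Fintype.linearCombination (MvPolynomial σ F)
      (fun j => LinearMap.proj j ∘ₗ coefficients x hx)) fun c => by
    rw [Fintype.linearCombination_apply]
    exact Submodule.sum_mem _ fun j _ => Submodule.smul_mem _ _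
      (AddSubgroup.mem_iSup_of_mem (-2) (proj_coefficients_mem_homDegree hx hdeg j))

theorem toGradedDual_apply (hdeg : ∀ i, x i ∈ polyGrading F σ 2)
    (c : Fin (m + 2) → MvPolynomial σ F) (f : stringModule x) :
    (toGradedDual hx hdeg c).1 f = ∑ j, c j * coefficients x hx f j :=
  linearCombination_proj_coefficients_apply hx c f

theorem toGradedDual_mem_homDegree (hdeg : ∀ i, x i ∈ polyGrading F σ 2) :
    toGradedDual hx hdeg ∈ homDegree (powGrading (Fin (m + 2)) (shift (polyGrading F σ) 2))
      (gradedDualGrading (stringGrading x)) 0 := by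
  intro i c hc d f hf
  change (toGradedDual hx hdeg c).1 f ∈ _
  rw [toGradedDual_apply]
  refine sum_mem fun j _ => ?_
  have h := mul_mem_polyGrading (hc j trivial) (coefficients_mem hx hdeg hf j)
  rwa [show 2 + i + (-2 + d) = 0 + i + d by ring] at h

theorem toSpanSingleton_mem_homDegree (hdeg : ∀ i, x i ∈ polyGrading F σ 2) :
    LinearMap.toSpanSingleton (MvPolynomial σ F) _ x ∈ homDegree (polyGrading F σ)
      (powGrading (Fin (m + 2)) (shift (polyGrading F σ) 2)) 0 := by
  intro i r hr j _
  have h := mul_mem_polyGrading hr (hdeg j)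
  rwa [add_comm, ← zero_add i] at h

theorem toSpanSingleton_injective (hx : ∀ j, x j ≠ 0) :
    Function.Injective (LinearMap.toSpanSingleton (MvPolynomial σ F) _ x) :=
  fun _ _ h => mul_right_cancel₀ (hx 0) (congrFun h 0)

theorem exact_toSpanSingleton_toGradedDual (hdeg : ∀ i, x i ∈ polyGrading F σ 2)
    (hli : LinearIndependent F x) :
    Function.Exact (LinearMap.toSpanSingleton (MvPolynomial σ F) _ x) (toGradedDual hx hdeg) := by
  intro c
  constructor
  · intro hc
    obtain ⟨r, hr⟩ := exists_eq_smul_of_forall_syzygy hx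
      (fun s j hj p hp => mem_span_of_mul_mem hdeg hli hj hp)
      (show (1 : Fin (m + 2)) ≠ 0 by simp) c (by
        intro h hh
        rw [← range_coefficients hx] at hh
        obtain ⟨f, rfl⟩ := hh
        rw [← toGradedDual_apply hx hdeg, hc]
        rfl)
    exact ⟨r, hr.symm⟩
  · rintro ⟨r, rfl⟩
    refine Subtype.ext (LinearMap.ext fun f => ?_)
    rw [toGradedDual_apply]
    have h : coefficients x hx f ∈ LinearMap.ker (Fintype.linearCombination _ x) := by
      rw [← range_coefficients hx]; exact LinearMap.mem_range_self _ f
    rw [LinearMap.mem_ker, Fintype.linearCombination_apply] at h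
    simp only [LinearMap.toSpanSingleton_apply, Pi.smul_apply, smul_eq_mul, mul_assoc,
      ← Finset.mul_sum]
    simp only [smul_eq_mul, mul_comm _ (x _)] at h
    rw [h, mul_zero]
    rfl

theorem toGradedDual_surjective (hm : 1 ≤ m) (hdeg : ∀ i, x i ∈ polyGrading F σ 2)
    (hli : LinearIndependent F x) : Function.Surjective (toGradedDual hx hdeg) := by
  rintro ⟨φ, hφ⟩
  let e : stringModule x ≃ₗ[MvPolynomial σ F]
      LinearMap.ker (Fintype.linearCombination (MvPolynomial σ F) x) :=
    (LinearEquiv.ofInjective _ (coefficients_injective hx)).trans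
      (LinearEquiv.ofEq _ _ (range_coefficients hx))
  obtain ⟨d, hd⟩ := exists_forall_syzygy_eq hx
    (fun s j hj p hp => mem_span_of_mul_mem hdeg hli hj hp)
    -- The hypothesis `1 ≤ m` supplies the three distinct indices.
    (a := ⟨0, by lia⟩) (b := ⟨1, by lia⟩) (c := ⟨2, by lia⟩) (by simp) (by simp) (by simp)
    (φ ∘ₗ e.symm.toLinearMap)
  refine ⟨d, Subtype.ext (LinearMap.ext fun f => ?_)⟩
  rw [toGradedDual_apply]
  have h := hd (e f)
  rw [LinearMap.comp_apply, LinearEquiv.coe_coe, e.symm_apply_apply] at h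
  exact h.symm

end GradedDual

end StringModule

theorem mainTheorem11 {F : Type*} [Field F] {σ : Type*} [Finite σ] {m : ℕ}
    (x : Fin (m + 2) → MvPolynomial σ F)
    (hdeg : ∀ i, x i ∈ StringModule.polyGrading F σ 2)
    (hx : LinearIndependent F x) :
    projectiveDimension
        (ModuleCat.of (MvPolynomial σ F) (StringModule.stringModule x)) = (m : WithBot ℕ∞) ∧
    (3 ≤ m + 2 →
      (∃ (ι : MvPolynomial σ F →ₗ[MvPolynomial σ F] (Fin (m + 2) → MvPolynomial σ F))
         (ψ : (Fin (m + 2) → MvPolynomial σ F) →ₗ[MvPolynomial σ F]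
            StringModule.gradedDual (F := F) (σ := σ) (StringModule.stringGrading x)),
        ι ∈ StringModule.homDegree (StringModule.polyGrading F σ)
            (StringModule.powGrading (Fin (m + 2))
              (StringModule.shift (StringModule.polyGrading F σ) 2)) 0 ∧
        ψ ∈ StringModule.homDegree
            (StringModule.powGrading (Fin (m + 2))
              (StringModule.shift (StringModule.polyGrading F σ) 2))
            (StringModule.gradedDualGrading (StringModule.stringGrading x)) 0 ∧
        Function.Injective ι ∧ Function.Exact ι ψ ∧ Function.Surjective ψ) ∧
      projectiveDimension
        (ModuleCat.of (MvPolynomial σ F)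
          (StringModule.gradedDual (F := F) (σ := σ) (StringModule.stringGrading x))) ≤ 1) := by
  have h0 : ∀ j, x j ≠ 0 := hx.ne_zero
  refine ⟨StringModule.projectiveDimension_stringModule h0
    (StringModule.isWeaklyRegular_ofFn hdeg hx) (StringModule.one_notMem_span hdeg), fun hm => ?_⟩
  have hinj := StringModule.toSpanSingleton_injective h0
  have hex := StringModule.exact_toSpanSingleton_toGradedDual h0 hdeg hx
  have hsurj := StringModule.toGradedDual_surjective h0 (by lia) hdeg hx
  refine ⟨⟨_, _, StringModule.toSpanSingleton_mem_homDegree hdeg,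
    StringModule.toGradedDual_mem_homDegree h0 hdeg, hinj, hex, hsurj⟩, ?_⟩
  refine (projectiveDimension_le_iff _ 1).2 ?_
  exact (StringModule.shortExact_moduleCatMk hinj hex hsurj).hasProjectiveDimensionLT_X₃ 1
    (StringModule.hasProjectiveDimensionLT_of_projective _ 0)
    (StringModule.hasProjectiveDimensionLT_of_projective _ 1)
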